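/- Let $\mathbb T=\mathbb R/\mathbb Z$ be the one-dimensional torus with Lebesgue measure, let $T>0$ and $m\in(1,2)$. Let $\mathcal H^1(\mathbb T)$ be the completion of $C^\infty(\mathbb T)$ (real-valued) for the norm $\|G\|_{\mathcal H^1}^2=\|G\|_{L^2(\mathbb T)}^2+\|\partial_uG\|_{L^2(\mathbb T)}^2$, and let $L^2([0,T];\mathcal H^1(\mathbb T))$ be the set of measurable functions $f:[0,T]\to\mathcal H^1(\mathbb T)$, up to equality for almost every time, with $\int_0^T\|f_s\|_{\mathcal H^1}^2\,ds<\infty$. Let $C^{1,2}([0,T]\times\mathbb T)$ be the set of functions $G:[0,T]\times\mathbb T\to\mathbb R$, once differentiable in time and twice in space, such that $G,\partial_sG,\partial_uG,\partial_{uu}G$ are continuous on $[0,T]\times\mathbb T$. Given a measurable $\rho^{\rm ini}:\mathbb T\to[0,1]$, a weak solution of the porous medium equation $\partial_t\rho=\partial_{uu}(\rho^m)$ on $[0,T]\times\mathbb T$ with initial profile $\rho^{\rm ini}$ is a function $\rho:[0,T]\times\mathbb T\to[0,1]$, with $\rho_t$ Lebesgue measurable on $\mathbb T$ for every $t\in[0,T]$,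 such that 1. $\rho^m\in L^2([0,T];\mathcal H^1(\mathbb T))$; 2. for every $t\in[0,T]$ and every $G\in C^{1,2}([0,T]\times\mathbb T)$, $$\int_{\mathbb T}\rho_t\,G_t\,du-\int_{\mathbb T}\rho^{\rm ini}\,G_0\,du-\int_0^t\Big\{\int_{\mathbb T}\rho_s\,\partial_sG_s\,du+\int_{\mathbb T}(\rho_s)^m\,\partial_{uu}G_s\,du\Big\}\,ds=0 .$$ Then the weak solution is unique: if $\rho^{(1)}$ and $\rho^{(2)}$ are two weak solutions with the same measurable initial profile $\rho^{\rm ini}:\mathbb T\to[0,1]$, then for every $t\in[0,T]$ one has $\rho^{(1)}_t(u)=\rho^{(2)}_t(u)$ for almost every $u\in\mathbb T$. -/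

import Mathlib

open MeasureTheory Set
open scoped ContDiff

/-- The derivative `∂_u G` of a function on the torus `𝕋 = ℝ / ℤ`. -/
noncomputable def torusDeriv (G : UnitAddCircle → ℝ) (u : UnitAddCircle) : ℝ :=
  deriv (fun h : ℝ => G (u + (h : UnitAddCircle))) 0

/-- `G ∈ C^n(𝕋)`: the 1-periodic function on `ℝ` that `G` corresponds to is of class `C^n`. -/
def TorusContDiff (n : ℕ∞) (G : UnitAddCircle → ℝ) : Prop :=
  ContDiff ℝ n (fun x : ℝ => G (x : UnitAddCircle))

/-- The real Hilbert space `L²(𝕋)`, for the Lebesgue measure (of total mass one). -/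
noncomputable abbrev TorusL2 : Type := Lp ℝ 2 (volume : Measure UnitAddCircle)

theorem torusDeriv_coe (G : UnitAddCircle → ℝ) (x : ℝ) :
    torusDeriv G (x : UnitAddCircle) = deriv (fun y : ℝ => G (y : UnitAddCircle)) x := by
  have h := deriv_comp_const_add (f := fun y : ℝ => G (y : UnitAddCircle)) x 0
  simpa [torusDeriv] using h

theorem TorusContDiff.differentiableAt {G : UnitAddCircle → ℝ} (hG : TorusContDiff ⊤ G)
    (x : ℝ) : DifferentiableAt ℝ (fun y : ℝ => G (y : UnitAddCircle)) x :=
  (ContDiff.differentiable hG (by simp)) x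

theorem torusDeriv_zero : torusDeriv (fun _ => 0) = fun _ => 0 := by
  funext u
  simp [torusDeriv]

theorem torusDeriv_add {G H : UnitAddCircle → ℝ} (hG : TorusContDiff ⊤ G)
    (hH : TorusContDiff ⊤ H) :
    torusDeriv (fun u => G u + H u) = fun u => torusDeriv G u + torusDeriv H u := by
  funext u
  induction u using QuotientAddGroup.induction_on with
  | H x =>
    simp only [torusDeriv_coe]
    exact deriv_fun_add (hG.differentiableAt x) (hH.differentiableAt x)

theorem torusDeriv_smul {G : UnitAddCircle → ℝ} (c : ℝ) (hG : TorusContDiff ⊤ G) :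
    torusDeriv (fun u => c * G u) = fun u => c * torusDeriv G u := by
  funext u
  induction u using QuotientAddGroup.induction_on with
  | H x =>
    simp only [torusDeriv_coe]
    exact deriv_const_mul c (hG.differentiableAt x)

/-- The image of `C^∞(𝕋)` in the Hilbert space `L²(𝕋) ⊕ L²(𝕋)` under the injective linear map
`G ↦ (G, ∂_u G)`. The norm it inherits is the Sobolev norm
`‖G‖² = ‖G‖²_{L²} + ‖∂_u G‖²_{L²}`. -/
noncomputable def smoothTorusGraph : Submodule ℝ (WithLp 2 (TorusL2 × TorusL2)) where
  carrier := {x | ∃ G : UnitAddCircle → ℝ, TorusContDiff ⊤ G ∧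
    (x.fst : UnitAddCircle → ℝ) =ᵐ[volume] G ∧
    (x.snd : UnitAddCircle → ℝ) =ᵐ[volume] torusDeriv G}
  zero_mem' := by
    refine ⟨fun _ => 0, contDiff_const, ?_, ?_⟩
    · exact Lp.coeFn_zero ℝ 2 volume
    · rw [torusDeriv_zero]
      exact Lp.coeFn_zero ℝ 2 volume
  add_mem' := by
    rintro x y ⟨G, hG, hG1, hG2⟩ ⟨H, hH, hH1, hH2⟩
    refine ⟨fun u => G u + H u, ContDiff.add hG hH, ?_, ?_⟩
    · filter_upwards [Lp.coeFn_add x.fst y.fst, hG1, hH1] with u h0 h1 h2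
      rw [WithLp.add_fst, h0, Pi.add_apply, h1, h2]
    · rw [torusDeriv_add hG hH]
      filter_upwards [Lp.coeFn_add x.snd y.snd, hG2, hH2] with u h0 h1 h2
      rw [WithLp.add_snd, h0, Pi.add_apply, h1, h2]
  smul_mem' := by
    rintro c x ⟨G, hG, hG1, hG2⟩
    refine ⟨fun u => c * G u, ContDiff.mul contDiff_const hG, ?_, ?_⟩
    · filter_upwards [Lp.coeFn_smul c x.fst, hG1] with u h0 h1
      rw [WithLp.smul_fst, h0, Pi.smul_apply, h1, smul_eq_mul]
    · rw [torusDeriv_smul c hG]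
      filter_upwards [Lp.coeFn_smul c x.snd, hG2] with u h0 h1
      rw [WithLp.smul_snd, h0, Pi.smul_apply, h1, smul_eq_mul]

/-- The Sobolev space `H¹(𝕋)`, the completion of `C^∞(𝕋)` for the Sobolev norm, realized as the
closure of `C^∞(𝕋)` in `L²(𝕋) ⊕ L²(𝕋)`: an element is a pair `(g, ∂_u g)` of a function and its
weak derivative, and its norm is the Sobolev norm. -/
noncomputable def TorusH1 : Submodule ℝ (WithLp 2 (TorusL2 × TorusL2)) :=
  smoothTorusGraph.topologicalClosure

/-- `g ∈ L²([0,T]; H¹(𝕋))`: there is a (strongly) measurable function `f : [0,T] → H¹(𝕋)` with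
`∫₀ᵀ ‖f_s‖²_{H¹} ds < ∞` such that, for almost every `s ∈ [0,T]`, `f_s` is the class of `g_s`. -/
def MemL2H1 (T : ℝ) (g : ℝ → UnitAddCircle → ℝ) : Prop :=
  ∃ f : ℝ → TorusH1, MemLp f 2 (volume.restrict (Icc 0 T)) ∧
    ∀ᵐ s ∂(volume.restrict (Icc 0 T)),
      ((f s : WithLp 2 (TorusL2 × TorusL2)).fst : UnitAddCircle → ℝ) =ᵐ[volume] g s

/-- The time derivative `∂_s G` on `[0,T] × 𝕋` (one-sided at the endpoints of `[0,T]`). -/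
noncomputable def timeDeriv (T : ℝ) (G : ℝ → UnitAddCircle → ℝ) (s : ℝ) (u : UnitAddCircle) : ℝ :=
  derivWithin (fun r => G r u) (Icc 0 T) s

/-- `G ∈ C^{1,2}([0,T] × 𝕋)`: once differentiable in time, twice in space, with `G`, `∂_s G`,
`∂_u G`, `∂_{uu} G` continuous on `[0,T] × 𝕋`. -/
structure IsC12 (T : ℝ) (G : ℝ → UnitAddCircle → ℝ) : Prop where
  time_differentiable : ∀ u, DifferentiableOn ℝ (fun s => G s u) (Icc 0 T)
  space_contDiff : ∀ s ∈ Icc 0 T, TorusContDiff 2 (G s)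
  continuous : ContinuousOn (fun p : ℝ × UnitAddCircle => G p.1 p.2) (Icc 0 T ×ˢ univ)
  continuous_time : ContinuousOn (fun p : ℝ × UnitAddCircle => timeDeriv T G p.1 p.2)
    (Icc 0 T ×ˢ univ)
  continuous_space : ContinuousOn (fun p : ℝ × UnitAddCircle => torusDeriv (G p.1) p.2)
    (Icc 0 T ×ˢ univ)
  continuous_space_space : ContinuousOn
    (fun p : ℝ × UnitAddCircle => torusDeriv (torusDeriv (G p.1)) p.2) (Icc 0 T ×ˢ univ)

/-- The functional `F(ρⁱⁿⁱ, ρ, G, t)` of the weak formulation of `∂_t ρ = ∂_{uu} (ρ^m)`. -/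
noncomputable def weakFunctional (T m : ℝ) (ρini : UnitAddCircle → ℝ)
    (ρ G : ℝ → UnitAddCircle → ℝ) (t : ℝ) : ℝ :=
  (∫ u, ρ t u * G t u) - (∫ u, ρini u * G 0 u)
    - ∫ s in (0 : ℝ)..t,
        ((∫ u, ρ s u * timeDeriv T G s u) + ∫ u, ρ s u ^ m * torusDeriv (torusDeriv (G s)) u)

/-- `ρ : [0,T] × 𝕋 → [0,1]` is a weak solution of the porous medium equation
`∂_t ρ = ∂_{uu} (ρ^m)`, `m ∈ (1,2)`, with initial profile `ρini`. The values of `ρ` at times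
outside `[0,T]` play no role. -/
structure IsWeakSolutionPME (T m : ℝ) (ρini : UnitAddCircle → ℝ)
    (ρ : ℝ → UnitAddCircle → ℝ) : Prop where
  mem_Icc : ∀ t ∈ Icc 0 T, ∀ u, ρ t u ∈ Icc (0 : ℝ) 1
  aemeasurable : ∀ t ∈ Icc 0 T, AEMeasurable (ρ t) volume
  power_memL2H1 : MemL2H1 T (fun t u => ρ t u ^ m)
  weak_formulation : ∀ t ∈ Icc 0 T, ∀ G : ℝ → UnitAddCircle → ℝ, IsC12 T G →
    weakFunctional T m ρini ρ G t = 0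

/-! The argument is the `H⁻¹` energy estimate, carried out mode by mode. Put `w = ρ₁ - ρ₂` and `h =
ρ₁^m - ρ₂^m`. Testing with a time-independent cosine or sine of frequency `k` shows that the mode of
`w` at time `t` is `-(2πk)²` times the time integral of the mode of `h`. Multiplying by the mode of
`h` and integrating in time yields, for `k ≠ 0`, the square of the mode of `w_t` divided by
`-2(2πk)²` (`integral_mode_mul_mode`). Summing over `k` by Parseval
(`hasSum_integral_mul_torusCos_add_torusSin`) gives `∫₀ᵗ ∫ w h = -‖w_t‖² / 2` in the homogeneous
`H⁻¹` norm. The left side is nonnegative because `r ↦ r^m` is increasing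
(`integral_sub_mul_rpow_sub_nonneg`), so every mode with `k ≠ 0` vanishes. The zero mode vanishes by
conservation of mass, and `ae_eq_zero_of_modes_eq_zero` concludes. -/

/-! ### Real trigonometric modes as eigenfunctions of the Laplacian. -/

/-- The real part `cos (2πku)` of the `k`-th Fourier monomial on the torus. -/
noncomputable def torusCos (k : ℤ) (u : UnitAddCircle) : ℝ := (fourier k u).re

/-- The imaginary part `sin (2πku)` of the `k`-th Fourier monomial on the torus. -/
noncomputable def torusSin (k : ℤ) (u : UnitAddCircle) : ℝ := (fourier k u).im

theorem torusCos_coe (k : ℤ) (x : ℝ) :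
    torusCos k (x : UnitAddCircle) = Real.cos (2 * Real.pi * k * x) := by
  have h : (2 * Real.pi * Complex.I * k * x / (1 : ℝ) : ℂ)
      = ((2 * Real.pi * k * x : ℝ) : ℂ) * Complex.I := by push_cast; ring
  rw [torusCos, fourier_coe_apply, h, Complex.exp_ofReal_mul_I_re]

theorem torusSin_coe (k : ℤ) (x : ℝ) :
    torusSin k (x : UnitAddCircle) = Real.sin (2 * Real.pi * k * x) := by
  have h : (2 * Real.pi * Complex.I * k * x / (1 : ℝ) : ℂ)
      = ((2 * Real.pi * k * x : ℝ) : ℂ) * Complex.I := by push_cast; ring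
  rw [torusSin, fourier_coe_apply, h, Complex.exp_ofReal_mul_I_im]

theorem continuous_torusCos (k : ℤ) : Continuous (torusCos k) :=
  Complex.continuous_re.comp (fourier k).continuous

theorem continuous_torusSin (k : ℤ) : Continuous (torusSin k) :=
  Complex.continuous_im.comp (fourier k).continuous

theorem torusContDiff_torusCos (n : ℕ∞) (k : ℤ) : TorusContDiff n (torusCos k) := by
  unfold TorusContDiff
  simp only [torusCos_coe]
  fun_prop

theorem torusContDiff_torusSin (n : ℕ∞) (k : ℤ) : TorusContDiff n (torusSin k) := by
  unfold TorusContDiff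
  simp only [torusSin_coe]
  fun_prop

theorem torusDeriv_torusCos (k : ℤ) :
    torusDeriv (torusCos k) = fun u => -(2 * Real.pi * k) * torusSin k u := by
  funext u
  induction u using QuotientAddGroup.induction_on with
  | H x =>
    have h : HasDerivAt (fun y : ℝ => Real.cos (2 * Real.pi * k * y))
        (-Real.sin (2 * Real.pi * k * x) * (2 * Real.pi * k * 1)) x :=
      ((hasDerivAt_id x).const_mul _).cos
    simp only [torusDeriv_coe, torusCos_coe, torusSin_coe]
    rw [h.deriv]
    ring

theorem torusDeriv_torusSin (k : ℤ) :
    torusDeriv (torusSin k) = fun u => (2 * Real.pi * k) * torusCos k u := by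
  funext u
  induction u using QuotientAddGroup.induction_on with
  | H x =>
    have h : HasDerivAt (fun y : ℝ => Real.sin (2 * Real.pi * k * y))
        (Real.cos (2 * Real.pi * k * x) * (2 * Real.pi * k * 1)) x :=
      ((hasDerivAt_id x).const_mul _).sin
    simp only [torusDeriv_coe, torusCos_coe, torusSin_coe]
    rw [h.deriv]
    ring

theorem torusDeriv_torusDeriv_torusCos (k : ℤ) :
    torusDeriv (torusDeriv (torusCos k)) = fun u => -(2 * Real.pi * k) ^ 2 * torusCos k u := by
  rw [torusDeriv_torusCos, torusDeriv_smul _ (torusContDiff_torusSin ⊤ k), torusDeriv_torusSin]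
  funext u
  ring

theorem torusDeriv_torusDeriv_torusSin (k : ℤ) :
    torusDeriv (torusDeriv (torusSin k)) = fun u => -(2 * Real.pi * k) ^ 2 * torusSin k u := by
  rw [torusDeriv_torusSin, torusDeriv_smul _ (torusContDiff_torusCos ⊤ k), torusDeriv_torusCos]
  funext u
  ring

/-! ### Fourier coefficients and Parseval's identity for bounded real functions. -/

theorem AEMeasurable.memLp_of_abs_le_one {f : UnitAddCircle → ℝ} (hf : AEMeasurable f volume)
    (hb : ∀ u, |f u| ≤ 1) (p : ENNReal) : MemLp f p volume :=
  MemLp.of_bound hf.aestronglyMeasurable 1 (Filter.Eventually.of_forall hb)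

theorem AEMeasurable.integrable_mul_continuous {f G : UnitAddCircle → ℝ}
    (hf : AEMeasurable f volume) (hb : ∀ u, |f u| ≤ 1) (hG : Continuous G) :
    Integrable (fun u => f u * G u) volume :=
  (hG.integrable_of_hasCompactSupport (HasCompactSupport.of_compactSpace G)).bdd_mul
    hf.aestronglyMeasurable (Filter.Eventually.of_forall hb)

/-- The Fourier coefficients of a real function in terms of its cosine and sine modes. -/
theorem fourierCoeff_ofReal {f : UnitAddCircle → ℝ} (hf : AEMeasurable f volume)
    (hb : ∀ u, |f u| ≤ 1) (k : ℤ) :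
    fourierCoeff (fun u => (f u : ℂ)) k =
      ((∫ u, f u * torusCos k u : ℝ) : ℂ) - (∫ u, f u * torusSin k u : ℝ) * Complex.I := by
  have hc := (hf.integrable_mul_continuous hb (continuous_torusCos k)).ofReal (𝕜 := ℂ)
  have hs := ((hf.integrable_mul_continuous hb (continuous_torusSin k)).ofReal (𝕜 := ℂ)).mul_const
    Complex.I
  rw [fourierCoeff, AddCircle.integral_haarAddCircle, inv_one, one_smul, ← integral_complex_ofReal,
    ← integral_complex_ofReal, ← integral_mul_const]
  refine Eq.trans ?_ (integral_sub hc hs)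
  refine integral_congr_ae (Filter.Eventually.of_forall fun u => ?_)
  simp only [fourier_neg, smul_eq_mul, torusCos, torusSin]
  apply Complex.ext <;> simp <;> ring

/-- Parseval's identity for bounded real functions on the torus. -/
theorem hasSum_integral_mul_torusCos_add_torusSin {f g : UnitAddCircle → ℝ}
    (hf : AEMeasurable f volume) (hfb : ∀ u, |f u| ≤ 1)
    (hg : AEMeasurable g volume) (hgb : ∀ u, |g u| ≤ 1) :
    HasSum (fun k : ℤ => (∫ u, f u * torusCos k u) * (∫ u, g u * torusCos k u)
      + (∫ u, f u * torusSin k u) * (∫ u, g u * torusSin k u)) (∫ u, f u * g u) := by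
  have hF : MemLp (fun u => (f u : ℂ)) 2 AddCircle.haarAddCircle :=
    (hf.memLp_of_abs_le_one hfb 2).ofReal.haarAddCircle
  have hG : MemLp (fun u => (g u : ℂ)) 2 AddCircle.haarAddCircle :=
    (hg.memLp_of_abs_le_one hgb 2).ofReal.haarAddCircle
  -- Coefficients `a - ib` and `a' - ib'` contribute `aa' + bb'` to the real part of the complex
  -- Parseval identity.
  have h := Complex.hasSum_re (fourierBasis.hasSum_inner_mul_inner hF.toLp hG.toLp)
  convert h using 1
  · funext k
    rw [← inner_conj_symm, ← fourierBasis.repr_apply_apply, ← fourierBasis.repr_apply_apply,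
      fourierBasis_repr, fourierBasis_repr, fourierCoeff_congr_ae hF.coeFn_toLp,
      fourierCoeff_congr_ae hG.coeFn_toLp, fourierCoeff_ofReal hf hfb, fourierCoeff_ofReal hg hgb]
    simp
  · rw [L2.inner_def]
    have h2 : (∫ u, inner ℂ (hF.toLp _ u) (hG.toLp _ u) ∂AddCircle.haarAddCircle)
        = ∫ u : UnitAddCircle, ((f u * g u : ℝ) : ℂ) ∂AddCircle.haarAddCircle := by
      refine integral_congr_ae ?_
      filter_upwards [hF.coeFn_toLp, hG.coeFn_toLp] with u h1 h2
      rw [h1, h2]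
      simp [mul_comm]
    rw [h2, AddCircle.integral_haarAddCircle, integral_complex_ofReal]
    simp

/-- A bounded real function all of whose Fourier modes vanish is zero almost everywhere. -/
theorem ae_eq_zero_of_modes_eq_zero {f : UnitAddCircle → ℝ} (hf : AEMeasurable f volume)
    (hfb : ∀ u, |f u| ≤ 1) (hc : ∀ k, ∫ u, f u * torusCos k u = 0)
    (hs : ∀ k, ∫ u, f u * torusSin k u = 0) : f =ᵐ[volume] 0 := by
  have h := hasSum_integral_mul_torusCos_add_torusSin hf hfb hf hfb
  simp only [hc, hs, mul_zero, add_zero] at h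
  have h0 : ∫ u, f u * f u = 0 := h.unique hasSum_zero
  have hi : Integrable (fun u => f u * f u) volume :=
    ((hf.memLp_of_abs_le_one hfb 2).integrable_sq).congr
      (Filter.Eventually.of_forall fun u => by simp [sq])
  rw [integral_eq_zero_iff_of_nonneg (fun u => mul_self_nonneg (f u)) hi] at h0
  filter_upwards [h0] with u hu
  simpa using hu

/-- The squares of the modes of a function with values in `[-1, 1]` sum to at most one. -/
theorem sum_sq_modes_le_one {f : UnitAddCircle → ℝ} (hf : AEMeasurable f volume)
    (hfb : ∀ u, |f u| ≤ 1) (S : Finset ℤ) :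
    ∑ k ∈ S, ((∫ u, f u * torusCos k u) ^ 2 + (∫ u, f u * torusSin k u) ^ 2) ≤ 1 := by
  have h := hasSum_integral_mul_torusCos_add_torusSin hf hfb hf hfb
  simp only [← sq] at h
  refine (sum_le_hasSum S (fun k _ => by positivity) h).trans ?_
  have hi : Integrable (fun u => f u ^ 2) volume := (hf.memLp_of_abs_le_one hfb 2).integrable_sq
  refine (integral_mono hi (integrable_const (1 : ℝ)) fun u => ?_).trans
    (by simp [measureReal_def])
  exact (sq_le_one_iff_abs_le_one _).2 (hfb u)

/-- Termwise `|ab + cd| ≤ (a² + b² + c² + d²) / 2`, then Bessel's inequality. The bound is uniform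
in `S`, so it serves as the dominating function when the sum over modes is exchanged with the time
integral. -/
theorem abs_sum_mul_modes_le_one {f g : UnitAddCircle → ℝ}
    (hf : AEMeasurable f volume) (hfb : ∀ u, |f u| ≤ 1)
    (hg : AEMeasurable g volume) (hgb : ∀ u, |g u| ≤ 1) (S : Finset ℤ) :
    |∑ k ∈ S, ((∫ u, f u * torusCos k u) * (∫ u, g u * torusCos k u)
      + (∫ u, f u * torusSin k u) * (∫ u, g u * torusSin k u))| ≤ 1 := by
  have h1 := sum_sq_modes_le_one hf hfb S
  have h2 := sum_sq_modes_le_one hg hgb S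
  have h3 : ∀ k ∈ S, |(∫ u, f u * torusCos k u) * (∫ u, g u * torusCos k u)
      + (∫ u, f u * torusSin k u) * (∫ u, g u * torusSin k u)| ≤
      (((∫ u, f u * torusCos k u) ^ 2 + (∫ u, f u * torusSin k u) ^ 2)
      + ((∫ u, g u * torusCos k u) ^ 2 + (∫ u, g u * torusSin k u) ^ 2)) / 2 := by
    intro k _
    generalize (∫ u, f u * torusCos k u) = a
    generalize (∫ u, g u * torusCos k u) = b
    generalize (∫ u, f u * torusSin k u) = c
    generalize (∫ u, g u * torusSin k u) = d
    rw [abs_le]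
    constructor
    · nlinarith [sq_nonneg (a + b), sq_nonneg (c + d)]
    · nlinarith [sq_nonneg (a - b), sq_nonneg (c - d)]
  refine (Finset.abs_sum_le_sum_abs _ _).trans ((Finset.sum_le_sum h3).trans ?_)
  rw [← Finset.sum_div, Finset.sum_add_distrib]
  linarith

/-! ### Time primitives, measurability in time, and admissible test functions. -/

/-- Since `q` is only integrable, its primitive is absolutely continuous and has derivative `q`
almost everywhere; this suffices to integrate the derivative of the squared primitive. -/
theorem integral_primitive_mul {q : ℝ → ℝ} {t : ℝ} (hq : IntervalIntegrable q volume 0 t) :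
    ∫ s in (0 : ℝ)..t, (∫ r in (0 : ℝ)..s, q r) * q s = (∫ r in (0 : ℝ)..t, q r) ^ 2 / 2 := by
  have hac := hq.absolutelyContinuousOnInterval_intervalIntegral (c := 0) (by simp)
  have h := hac.integral_deriv_mul_eq_sub hac
  have h' : ∫ s in (0 : ℝ)..t, (deriv (fun x => ∫ r in (0 : ℝ)..x, q r) s * (∫ r in (0 : ℝ)..s, q r)
      + (∫ r in (0 : ℝ)..s, q r) * deriv (fun x => ∫ r in (0 : ℝ)..x, q r) s)
      = ∫ s in (0 : ℝ)..t, 2 * ((∫ r in (0 : ℝ)..s, q r) * q s) := by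
    refine intervalIntegral.integral_congr_ae ?_
    filter_upwards [hq.ae_hasDerivAt_integral] with s hs hst
    rw [(hs (uIoc_subset_uIcc hst) 0 (by simp)).deriv]
    ring
  rw [h', intervalIntegral.integral_const_mul, intervalIntegral.integral_same] at h
  linarith

/-- Joint measurability of `g` in time and space is not assumed. Pairing with `G` is a continuous
functional on `H¹`, so measurability in time is inherited from the `H¹`-valued representative. This
is what the Sobolev condition contributes to the uniqueness proof. -/
theorem MemL2H1.aestronglyMeasurable_integral_mul {T : ℝ} {g : ℝ → UnitAddCircle → ℝ}
    (hg : MemL2H1 T g) {G : UnitAddCircle → ℝ} (hG : Continuous G) :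
    AEStronglyMeasurable (fun s => ∫ u, g s u * G u) (volume.restrict (Icc 0 T)) := by
  obtain ⟨f, hf, hfg⟩ := hg
  have hG2 : MemLp G 2 volume := hG.memLp_of_hasCompactSupport (HasCompactSupport.of_compactSpace G)
  have hc : Continuous fun x : TorusH1 =>
      inner ℝ (hG2.toLp G) (x : WithLp 2 (TorusL2 × TorusL2)).fst :=
    continuous_const.inner ((WithLp.continuous_fst ..).comp continuous_subtype_val)
  refine (hc.comp_aestronglyMeasurable hf.aestronglyMeasurable).congr ?_
  filter_upwards [hfg] with s hs
  rw [L2.inner_def]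
  refine integral_congr_ae ?_
  filter_upwards [hs, hG2.coeFn_toLp] with u h1 h2
  rw [h1, h2]
  simp

/-- A smooth eigenfunction of the Laplacian, constant in time, is an admissible test function. -/
theorem isC12_const {T c : ℝ} {G : UnitAddCircle → ℝ} (hG : TorusContDiff ⊤ G)
    (hGc : Continuous G) (hG' : Continuous (torusDeriv G))
    (hG'' : torusDeriv (torusDeriv G) = fun u => c * G u) : IsC12 T (fun _ => G) where
  time_differentiable _ := differentiableOn_const _
  space_contDiff _ _ := ContDiff.of_le hG (by exact_mod_cast le_top)
  continuous := (hGc.comp continuous_snd).continuousOn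
  continuous_time := by simpa [timeDeriv] using continuousOn_const
  continuous_space := (hG'.comp continuous_snd).continuousOn
  continuous_space_space := by
    simp only [hG'']
    exact (continuous_const.mul (hGc.comp continuous_snd)).continuousOn

/-! ### Bounds, mode equations and energy identity for weak solutions. -/

namespace IsWeakSolutionPME

variable {T m : ℝ} {ρini : UnitAddCircle → ℝ} {ρ ρ₁ ρ₂ : ℝ → UnitAddCircle → ℝ}

theorem abs_le_one (h : IsWeakSolutionPME T m ρini ρ) {t : ℝ} (ht : t ∈ Icc 0 T)
    (u : UnitAddCircle) : |ρ t u| ≤ 1 :=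
  abs_le.2 ⟨by linarith [(h.mem_Icc t ht u).1], (h.mem_Icc t ht u).2⟩

theorem rpow_mem_Icc (h : IsWeakSolutionPME T m ρini ρ) (hm : 0 ≤ m) {t : ℝ} (ht : t ∈ Icc 0 T)
    (u : UnitAddCircle) : ρ t u ^ m ∈ Icc (0 : ℝ) 1 :=
  ⟨Real.rpow_nonneg (h.mem_Icc t ht u).1 _,
    Real.rpow_le_one (h.mem_Icc t ht u).1 (h.mem_Icc t ht u).2 hm⟩

theorem abs_rpow_le_one (h : IsWeakSolutionPME T m ρini ρ) (hm : 0 ≤ m) {t : ℝ}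
    (ht : t ∈ Icc 0 T) (u : UnitAddCircle) : |ρ t u ^ m| ≤ 1 :=
  abs_le.2 ⟨by linarith [(h.rpow_mem_Icc hm ht u).1], (h.rpow_mem_Icc hm ht u).2⟩

theorem abs_sub_le_one (h₁ : IsWeakSolutionPME T m ρini ρ₁) (h₂ : IsWeakSolutionPME T m ρini ρ₂)
    {t : ℝ} (ht : t ∈ Icc 0 T) (u : UnitAddCircle) : |ρ₁ t u - ρ₂ t u| ≤ 1 := by
  have a := h₁.mem_Icc t ht u
  have b := h₂.mem_Icc t ht u
  exact abs_le.2 ⟨by linarith [a.1, b.2], by linarith [a.2, b.1]⟩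

theorem abs_rpow_sub_rpow_le_one (h₁ : IsWeakSolutionPME T m ρini ρ₁)
    (h₂ : IsWeakSolutionPME T m ρini ρ₂) (hm : 0 ≤ m)
    {t : ℝ} (ht : t ∈ Icc 0 T) (u : UnitAddCircle) : |ρ₁ t u ^ m - ρ₂ t u ^ m| ≤ 1 := by
  have a := h₁.rpow_mem_Icc hm ht u
  have b := h₂.rpow_mem_Icc hm ht u
  exact abs_le.2 ⟨by linarith [a.1, b.2], by linarith [a.2, b.1]⟩

theorem aemeasurable_rpow (h : IsWeakSolutionPME T m ρini ρ) {t : ℝ} (ht : t ∈ Icc 0 T) :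
    AEMeasurable (fun u => ρ t u ^ m) volume :=
  (h.aemeasurable t ht).pow_const m

/-- Monotonicity of `r ↦ r^m` on `[0, ∞)` makes the integrand a product of two factors of the same
sign. -/
theorem integral_sub_mul_rpow_sub_nonneg (h₁ : IsWeakSolutionPME T m ρini ρ₁)
    (h₂ : IsWeakSolutionPME T m ρini ρ₂) (hm : 0 ≤ m) {t : ℝ} (ht : t ∈ Icc 0 T) :
    0 ≤ ∫ u, (ρ₁ t u - ρ₂ t u) * (ρ₁ t u ^ m - ρ₂ t u ^ m) := by
  refine integral_nonneg fun u => ?_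
  have a := (h₁.mem_Icc t ht u).1
  have b := (h₂.mem_Icc t ht u).1
  rcases le_total (ρ₁ t u) (ρ₂ t u) with h | h
  · exact mul_nonneg_of_nonpos_of_nonpos (sub_nonpos.2 h)
      (sub_nonpos.2 (Real.rpow_le_rpow a h hm))
  · exact mul_nonneg (sub_nonneg.2 h) (sub_nonneg.2 (Real.rpow_le_rpow b h hm))

theorem integrableOn_integral_rpow_mul (h : IsWeakSolutionPME T m ρini ρ) (hm : 0 ≤ m)
    {G : UnitAddCircle → ℝ} (hG : Continuous G) :
    IntegrableOn (fun s => ∫ u, ρ s u ^ m * G u) (Icc 0 T) volume := by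
  refine IntegrableOn.of_bound measure_Icc_lt_top
    (h.power_memL2H1.aestronglyMeasurable_integral_mul hG) (∫ u, |G u|) ?_
  refine (ae_restrict_iff' measurableSet_Icc).2 (Filter.Eventually.of_forall fun s hs => ?_)
  refine norm_integral_le_of_norm_le
    (hG.abs.integrable_of_hasCompactSupport (HasCompactSupport.of_compactSpace _))
    (Filter.Eventually.of_forall fun u => ?_)
  rw [norm_mul]
  exact mul_le_of_le_one_left (abs_nonneg _) (h.abs_rpow_le_one hm hs u)

theorem integrableOn_integral_rpow_sub_mul (h₁ : IsWeakSolutionPME T m ρini ρ₁)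
    (h₂ : IsWeakSolutionPME T m ρini ρ₂) (hm : 0 ≤ m) {G : UnitAddCircle → ℝ}
    (hG : Continuous G) :
    IntegrableOn (fun s => ∫ u, (ρ₁ s u ^ m - ρ₂ s u ^ m) * G u) (Icc 0 T) volume := by
  refine IntegrableOn.congr_fun ((h₁.integrableOn_integral_rpow_mul hm hG).sub
    (h₂.integrableOn_integral_rpow_mul hm hG)) (fun s hs => ?_) measurableSet_Icc
  simp only [Pi.sub_apply, sub_mul]
  exact (integral_sub
    ((h₁.aemeasurable_rpow hs).integrable_mul_continuous (h₁.abs_rpow_le_one hm hs) hG)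
    ((h₂.aemeasurable_rpow hs).integrable_mul_continuous (h₂.abs_rpow_le_one hm hs) hG)).symm

/-- A test function constant in time removes the `∂_s` term, and the eigenvalue relation turns the
diffusion term into a multiple of the mode of `ρ^m`. -/
theorem integral_mul_eq (h : IsWeakSolutionPME T m ρini ρ)
    {c : ℝ} {G : UnitAddCircle → ℝ} (hG : TorusContDiff ⊤ G)
    (hGc : Continuous G) (hG' : Continuous (torusDeriv G))
    (hG'' : torusDeriv (torusDeriv G) = fun u => c * G u) {t : ℝ} (ht : t ∈ Icc 0 T) :
    ∫ u, ρ t u * G u = (∫ u, ρini u * G u) + c * ∫ s in (0 : ℝ)..t, ∫ u, ρ s u ^ m * G u := by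
  have hw := h.weak_formulation t ht (fun _ => G) (isC12_const hG hGc hG' hG'')
  have e : ∀ s, ((∫ u, ρ s u * timeDeriv T (fun _ => G) s u)
      + ∫ u, ρ s u ^ m * torusDeriv (torusDeriv G) u) = c * ∫ u, ρ s u ^ m * G u := by
    intro s
    rw [hG'', ← integral_const_mul]
    simp [timeDeriv, mul_left_comm]
  simp only [weakFunctional, e, intervalIntegral.integral_const_mul] at hw
  linarith

/-- The mode of the difference of two weak solutions along a Laplace eigenfunction. -/
theorem integral_sub_mul_eq (h₁ : IsWeakSolutionPME T m ρini ρ₁)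
    (h₂ : IsWeakSolutionPME T m ρini ρ₂) (hm : 0 ≤ m)
    {c : ℝ} {G : UnitAddCircle → ℝ} (hG : TorusContDiff ⊤ G)
    (hGc : Continuous G) (hG' : Continuous (torusDeriv G))
    (hG'' : torusDeriv (torusDeriv G) = fun u => c * G u) {t : ℝ} (ht : t ∈ Icc 0 T) :
    ∫ u, (ρ₁ t u - ρ₂ t u) * G u
      = c * ∫ s in (0 : ℝ)..t, ∫ u, (ρ₁ s u ^ m - ρ₂ s u ^ m) * G u := by
  have hsub : uIcc 0 t ⊆ Icc 0 T := by
    rw [uIcc_of_le ht.1]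
    exact Icc_subset_Icc_right ht.2
  have e : ∫ s in (0 : ℝ)..t, ∫ u, (ρ₁ s u ^ m - ρ₂ s u ^ m) * G u
      = (∫ s in (0 : ℝ)..t, ∫ u, ρ₁ s u ^ m * G u) - ∫ s in (0 : ℝ)..t, ∫ u, ρ₂ s u ^ m * G u := by
    rw [← intervalIntegral.integral_sub
      ((h₁.integrableOn_integral_rpow_mul hm hGc).mono_set hsub).intervalIntegrable
      ((h₂.integrableOn_integral_rpow_mul hm hGc).mono_set hsub).intervalIntegrable]
    refine intervalIntegral.integral_congr fun s hs => ?_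
    have hs' := hsub hs
    simp only [sub_mul]
    exact integral_sub
      ((h₁.aemeasurable_rpow hs').integrable_mul_continuous (h₁.abs_rpow_le_one hm hs') hGc)
      ((h₂.aemeasurable_rpow hs').integrable_mul_continuous (h₂.abs_rpow_le_one hm hs') hGc)
  have e2 : ∫ u, (ρ₁ t u - ρ₂ t u) * G u = (∫ u, ρ₁ t u * G u) - ∫ u, ρ₂ t u * G u := by
    simp only [sub_mul]
    exact integral_sub
      ((h₁.aemeasurable t ht).integrable_mul_continuous (h₁.abs_le_one ht) hGc)
      ((h₂.aemeasurable t ht).integrable_mul_continuous (h₂.abs_le_one ht) hGc)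
  rw [e, e2, h₁.integral_mul_eq hG hGc hG' hG'' ht, h₂.integral_mul_eq hG hGc hG' hG'' ht]
  ring

/-- The energy identity for the mode of the difference of two weak solutions along a Laplace
eigenfunction with eigenvalue `c`. For `c = 0` both sides vanish. -/
theorem integral_mode_mul_mode (h₁ : IsWeakSolutionPME T m ρini ρ₁)
    (h₂ : IsWeakSolutionPME T m ρini ρ₂) (hm : 0 ≤ m)
    {c : ℝ} {G : UnitAddCircle → ℝ} (hG : TorusContDiff ⊤ G)
    (hGc : Continuous G) (hG' : Continuous (torusDeriv G))
    (hG'' : torusDeriv (torusDeriv G) = fun u => c * G u) {t : ℝ} (ht : t ∈ Icc 0 T) :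
    IntervalIntegrable (fun s => (∫ u, (ρ₁ s u - ρ₂ s u) * G u)
        * ∫ u, (ρ₁ s u ^ m - ρ₂ s u ^ m) * G u) volume 0 t ∧
    ∫ s in (0 : ℝ)..t, (∫ u, (ρ₁ s u - ρ₂ s u) * G u)
        * (∫ u, (ρ₁ s u ^ m - ρ₂ s u ^ m) * G u)
      = (∫ u, (ρ₁ t u - ρ₂ t u) * G u) ^ 2 / (2 * c) := by
  have hsub : uIcc 0 t ⊆ Icc 0 T := by
    rw [uIcc_of_le ht.1]
    exact Icc_subset_Icc_right ht.2
  set q : ℝ → ℝ := fun s => ∫ u, (ρ₁ s u ^ m - ρ₂ s u ^ m) * G u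
  have hq : IntervalIntegrable q volume 0 t :=
    ((h₁.integrableOn_integral_rpow_sub_mul h₂ hm hGc).mono_set hsub).intervalIntegrable
  have hp : ∀ s ∈ Icc 0 T, ∫ u, (ρ₁ s u - ρ₂ s u) * G u = c * ∫ r in (0 : ℝ)..s, q r :=
    fun s hs => h₁.integral_sub_mul_eq h₂ hm hG hGc hG' hG'' hs
  have hpq : ∀ s ∈ uIcc 0 t, (∫ u, (ρ₁ s u - ρ₂ s u) * G u) * q s
      = c * ((∫ r in (0 : ℝ)..s, q r) * q s) := fun s hs => by rw [hp s (hsub hs), mul_assoc]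
  have hac := hq.absolutelyContinuousOnInterval_intervalIntegral (c := 0) (by simp)
  constructor
  -- The mode of `w` is a multiple of the primitive of `q`, hence continuous in time, and its
  -- product with the integrable `q` is integrable.
  · refine ((hq.continuousOn_mul hac.continuousOn).const_mul c).congr fun s hs => ?_
    exact (hpq s (uIoc_subset_uIcc hs)).symm
  · rw [intervalIntegral.integral_congr hpq, intervalIntegral.integral_const_mul,
      integral_primitive_mul hq, hp t ht]
    rcases eq_or_ne c 0 with rfl | hc
    · simp
    · field_simp

end IsWeakSolutionPME

/-! ### Summation over the modes and conclusion. -/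

theorem lemmaB3 (T m : ℝ) (hT : 0 < T) (hm : m ∈ Ioo (1 : ℝ) 2)
    (ρini : UnitAddCircle → ℝ) (hρini : Measurable ρini)
    (hρini01 : ∀ u, ρini u ∈ Icc (0 : ℝ) 1)
    (ρ₁ ρ₂ : ℝ → UnitAddCircle → ℝ)
    (h₁ : IsWeakSolutionPME T m ρini ρ₁) (h₂ : IsWeakSolutionPME T m ρini ρ₂) :
    ∀ t ∈ Icc 0 T, ρ₁ t =ᵐ[volume] ρ₂ t := by
  intro t ht
  have hm0 : 0 ≤ m := by linarith [hm.1]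
  have hsub : uIcc 0 t ⊆ Icc 0 T := by
    rw [uIcc_of_le ht.1]
    exact Icc_subset_Icc_right ht.2
  have hcos' : ∀ k, Continuous (torusDeriv (torusCos k)) := fun k => by
    rw [torusDeriv_torusCos]
    exact continuous_const.mul (continuous_torusSin k)
  have hsin' : ∀ k, Continuous (torusDeriv (torusSin k)) := fun k => by
    rw [torusDeriv_torusSin]
    exact continuous_const.mul (continuous_torusCos k)
  have hcos := fun k => h₁.integral_mode_mul_mode h₂ hm0 (torusContDiff_torusCos ⊤ k)
    (continuous_torusCos k) (hcos' k) (torusDeriv_torusDeriv_torusCos k) ht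
  have hsin := fun k => h₁.integral_mode_mul_mode h₂ hm0 (torusContDiff_torusSin ⊤ k)
    (continuous_torusSin k) (hsin' k) (torusDeriv_torusDeriv_torusSin k) ht
  have hw : ∀ s ∈ Icc 0 T, AEMeasurable (fun u => ρ₁ s u - ρ₂ s u) volume :=
    fun s hs => (h₁.aemeasurable s hs).sub (h₂.aemeasurable s hs)
  have hh : ∀ s ∈ Icc 0 T, AEMeasurable (fun u => ρ₁ s u ^ m - ρ₂ s u ^ m) volume :=
    fun s hs => (h₁.aemeasurable_rpow hs).sub (h₂.aemeasurable_rpow hs)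
  set e : ℤ → ℝ → ℝ := fun k s =>
    (∫ u, (ρ₁ s u - ρ₂ s u) * torusCos k u) * (∫ u, (ρ₁ s u ^ m - ρ₂ s u ^ m) * torusCos k u)
    + (∫ u, (ρ₁ s u - ρ₂ s u) * torusSin k u) * (∫ u, (ρ₁ s u ^ m - ρ₂ s u ^ m) * torusSin k u)
    with he
  have hei : ∀ k, IntervalIntegrable (e k) volume 0 t := fun k => (hcos k).1.add (hsin k).1
  have heq : ∀ k, ∫ s in (0 : ℝ)..t, e k s = ((∫ u, (ρ₁ t u - ρ₂ t u) * torusCos k u) ^ 2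
      + (∫ u, (ρ₁ t u - ρ₂ t u) * torusSin k u) ^ 2) / (2 * -(2 * Real.pi * k) ^ 2) := fun k => by
    rw [he, intervalIntegral.integral_add (hcos k).1 (hsin k).1, (hcos k).2, (hsin k).2, add_div]
  have hsum : HasSum (fun k => ∫ s in (0 : ℝ)..t, e k s)
      (∫ s in (0 : ℝ)..t, ∫ u, (ρ₁ s u - ρ₂ s u) * (ρ₁ s u ^ m - ρ₂ s u ^ m)) := by
    -- Dominated convergence along finite sets of frequencies, with bound `1` and with Parseval as
    -- the pointwise limit at each time.
    have hlim := intervalIntegral.tendsto_integral_filter_of_dominated_convergence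
      (μ := volume) (a := 0) (b := t) (l := Filter.atTop)
      (F := fun (S : Finset ℤ) s => ∑ k ∈ S, e k s)
      (f := fun s => ∫ u, (ρ₁ s u - ρ₂ s u) * (ρ₁ s u ^ m - ρ₂ s u ^ m)) (fun _ => (1 : ℝ))
      (Filter.Eventually.of_forall fun S =>
        Finset.aestronglyMeasurable_fun_sum S fun k _ => (hei k).aestronglyMeasurable_restrict_uIoc)
      (Filter.Eventually.of_forall fun S => Filter.Eventually.of_forall fun s hs =>
        have hs' := hsub (uIoc_subset_uIcc hs)
        abs_sum_mul_modes_le_one (hw s hs') (h₁.abs_sub_le_one h₂ hs') (hh s hs')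
          (h₁.abs_rpow_sub_rpow_le_one h₂ hm0 hs') S)
      intervalIntegrable_const
      (Filter.Eventually.of_forall fun s hs =>
        have hs' := hsub (uIoc_subset_uIcc hs)
        hasSum_integral_mul_torusCos_add_torusSin (hw s hs') (h₁.abs_sub_le_one h₂ hs')
          (hh s hs') (h₁.abs_rpow_sub_rpow_le_one h₂ hm0 hs'))
    refine hlim.congr fun S => ?_
    exact intervalIntegral.integral_finsetSum fun k _ => hei k
  have hnonneg : 0 ≤ ∫ s in (0 : ℝ)..t, ∫ u, (ρ₁ s u - ρ₂ s u) * (ρ₁ s u ^ m - ρ₂ s u ^ m) :=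
    intervalIntegral.integral_nonneg ht.1 fun s hs =>
      h₁.integral_sub_mul_rpow_sub_nonneg h₂ hm0 ⟨hs.1, hs.2.trans ht.2⟩
  have hnonpos : ∀ k, ∫ s in (0 : ℝ)..t, e k s ≤ 0 := fun k => by
    rw [heq]
    refine div_nonpos_of_nonneg_of_nonpos (by positivity) ?_
    linarith [sq_nonneg (2 * Real.pi * k)]
  have hzero : ∀ k, (∫ u, (ρ₁ t u - ρ₂ t u) * torusCos k u) = 0
      ∧ (∫ u, (ρ₁ t u - ρ₂ t u) * torusSin k u) = 0 := by
    intro k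
    -- At `k = 0` the energy identity reads `0 = 0` because of division by zero, so it carries no
    -- information; the mode equation with eigenvalue `0` is used instead.
    rcases eq_or_ne k 0 with rfl | hk
    · constructor
      · rw [h₁.integral_sub_mul_eq h₂ hm0 (torusContDiff_torusCos ⊤ 0) (continuous_torusCos 0)
          (hcos' 0) (torusDeriv_torusDeriv_torusCos 0) ht]
        simp
      · rw [h₁.integral_sub_mul_eq h₂ hm0 (torusContDiff_torusSin ⊤ 0) (continuous_torusSin 0)
          (hsin' 0) (torusDeriv_torusDeriv_torusSin 0) ht]
        simp
    -- All terms are nonpositive while their sum is nonnegative, so each single term is zero.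
    · have hle := le_hasSum hsum.neg k fun j _ => neg_nonneg.2 (hnonpos j)
      have hk0 : 0 ≤ ∫ s in (0 : ℝ)..t, e k s := by linarith
      have h0 := le_antisymm (hnonpos k) hk0
      have hc : 2 * -(2 * Real.pi * (k : ℝ)) ^ 2 ≠ 0 := by
        simp [Real.pi_ne_zero, hk]
      rw [heq, div_eq_zero_iff, or_iff_left hc] at h0
      constructor <;> refine pow_eq_zero_iff two_ne_zero |>.1 ?_ <;>
        linarith [sq_nonneg (∫ u, (ρ₁ t u - ρ₂ t u) * torusCos k u),
          sq_nonneg (∫ u, (ρ₁ t u - ρ₂ t u) * torusSin k u)]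
  filter_upwards [ae_eq_zero_of_modes_eq_zero (hw t ht) (h₁.abs_sub_le_one h₂ ht)
    (fun k => (hzero k).1) (fun k => (hzero k).2)] with u hu
  exact sub_eq_zero.1 hu
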